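/- Let $G$ be a finite group and let $N$ be a normal subgroup of $G$; all characters are complex characters. For a normal subgroup $M$ of $G$ put $C(G\mid M)=\langle C_G(x) : 1\neq x\in M\rangle$, and let $I(G\mid N)$ be the product of all normal subgroups $M$ of $G$ with $C(G\mid M)\le N$. Let $\pi=\pi(G/N)$ be the set of prime divisors of $|G:N|$, and let $O_{\pi'}(G)$ be the largest normal subgroup of $G$ whose order is divisible by no prime in $\pi$. Write $\mathrm{Irr}(N\mid M)$ for the set of $\psi\in\mathrm{Irr}(N)$ with $M\not\le\ker\psi$, and, for $\psi\in\mathrm{Irr}(N)$, let $\psi^G$ be the induced character and $I_G(\psi)$ the stabilizer of $\psi$ under the action of $G$ on $\mathrm{Irr}(N)$ induced by conjugation. Then: 1. A normal subgroup $M$ of $G$ satisfies $M\le I(G\mid N)$ if and only if $M\le O_{\pi'}(G)$ and $\psi^G\in\mathrm{Irr}(G)$ for every $\psi\in\mathrm{Irr}(N\mid M)$. 2. $$I(G\mid N)=O_{\pi'}(G)\cap\bigcap_{\substack{\psi\in\mathrm{Irr}(N)\\ I_G(\psi)>N}}\ker(\psi),$$ where for $N=G$ the empty intersection is read as $G$.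 -/

import Mathlib

namespace FrobeniusTriple

/-- `Irr(G)`: the set of ordinary (complex) irreducible characters of `G`, as functions on `G`. -/
def Irr (G : Type*) [Group G] : Set (G → ℂ) :=
  {χ | ∃ (n : ℕ) (ρ : Representation ℂ G (Fin n → ℂ)), ρ.IsIrreducible ∧ ρ.character = χ}

/-- The kernel of a character `χ`, i.e. the elements on which `χ` takes the value `χ(1)`. -/
def charKer {G : Type*} [Group G] (χ : G → ℂ) : Set G :=
  {g | χ g = χ 1}

section Subgroups

variable {G : Type*} [Group G]

/-- `Irr(N ∣ M)`: the irreducible characters of `N` whose kernel, viewed as a subset of `G`,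
does not contain `M`. -/
def IrrOver (N M : Subgroup G) : Set (N → ℂ) :=
  {ψ | ψ ∈ Irr N ∧ ¬ (M : Set G) ⊆ Subtype.val '' charKer ψ}

open Classical in
/-- The induced class function
`ψ^G(g) = |N|⁻¹ ∑_{x ∈ G} ψ°(x g x⁻¹)`, where `ψ°` is `ψ` on `N` and `0` off `N`. -/
noncomputable def indChar [Fintype G] (N : Subgroup G) (ψ : N → ℂ) : G → ℂ := fun g =>
  (Nat.card N : ℂ)⁻¹ * ∑ x : G, if h : x * g * x⁻¹ ∈ N then ψ ⟨x * g * x⁻¹, h⟩ else 0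

/-- `I_G(ψ)`: the stabilizer in `G` of a function `ψ` on the normal subgroup `N`, for the action
of `G` induced by conjugation on `N`. -/
def inertia {N : Subgroup G} [N.Normal] (ψ : N → ℂ) : Subgroup G where
  carrier := {g | ∀ n : N, ψ (MulAut.conjNormal g n) = ψ n}
  one_mem' := fun n => by simp
  mul_mem' := fun {a b} ha hb n => by
    rw [map_mul, MulAut.mul_apply, ha, hb]
  inv_mem' := fun {a} ha n => by
    rw [← ha (MulAut.conjNormal a⁻¹ n), ← MulAut.mul_apply, ← map_mul, mul_inv_cancel, map_one,
      MulAut.one_apply]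

/-- `C(G ∣ M)`: the subgroup generated by the centralizers in `G` of the nonidentity elements
of `M`. -/
def centGen (M : Subgroup G) : Subgroup G :=
  ⨆ x ∈ {x : G | x ∈ M ∧ x ≠ 1}, Subgroup.centralizer {x}

/-- `I(G ∣ N)`: the product of all normal subgroups `M` of `G` with `C(G ∣ M) ≤ N`. -/
def frobI (N : Subgroup G) : Subgroup G :=
  sSup {M : Subgroup G | M.Normal ∧ centGen M ≤ N}

end Subgroups

/-- `π(G)`: the set of prime divisors of the order of `G`. -/
def primesOf (G : Type*) [Group G] : Set ℕ :=
  {p | p.Prime ∧ p ∣ Nat.card G}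

/-- `O_π(G)`: the product of all normal `π`-subgroups of `G`, a `π`-subgroup being one all of
whose prime divisors of the order lie in `π`. -/
def piCore (π : Set ℕ) (G : Type*) [Group G] : Subgroup G :=
  sSup {K : Subgroup G | K.Normal ∧ primesOf K ⊆ π}

end FrobeniusTriple

/-! The core is `centGen_le_iff_forall_indChar`: for normal `M`, no element outside `N` commutes
with a nontrivial element of `M` iff `M` is a `π'`-group and every `ψ ∈ Irr(N ∣ M)` induces
irreducibly. Forward: a Sylow fixed-point count gives `π'`. If `g ∉ N` stabilized `ψ`, an
intertwiner `S` from `ψ` to its conjugate would have `tr (S ρ(n)) = 0` for all `n`, since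
commutation with `g n` permutes `M` and `∑ ρ(m) = 0` over `M`; then `S = 0`. Backward: each `χ ∈ Irr
G` either has `M` in its kernel or vanishes off `N`, so `g` and `g x` are conjugate for `g ∉ N`, `x
∈ M`. With `g` a `p`-element commuting with `x`, `p ∈ π`, this forces `x = 1`. The character
condition passes to joins, so `frobI N` satisfies it and is the largest such subgroup. As `ψ`
induces irreducibly iff its stabilizer is `N`, the condition says that `M` lies in `O_{π'}(G)` and
in the kernel of every `ψ` with larger stabilizer. -/

namespace FrobeniusTriple

open Representation Module
open scoped MonoidAlgebra

/-! ### Irreducibility and transport of representations. -/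

section Transport

variable {G V W : Type*} [Group G] [AddCommGroup V] [Module ℂ V] [AddCommGroup W] [Module ℂ W]

/-- Irreducibility only depends on the lattice of invariant subspaces. -/
theorem isIrreducible_iff_forall_submodule (ρ : Representation ℂ G V) :
    ρ.IsIrreducible ↔ Nontrivial V ∧
      ∀ U : Submodule ℂ V, (∀ g, ∀ v ∈ U, ρ g v ∈ U) → U = ⊥ ∨ U = ⊤ := by
  constructor
  · intro h
    constructor
    · by_contra hV
      rw [not_nontrivial_iff_subsingleton] at hV
      refine bot_ne_top (α := Subrepresentation ρ) ?_
      apply Subrepresentation.toSubmodule_injective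
      exact Subsingleton.elim _ _
    · intro U hU
      rcases h.eq_bot_or_eq_top (⟨U, fun g v hv => hU g v hv⟩ : Subrepresentation ρ) with h | h
      · left; exact congrArg Subrepresentation.toSubmodule h
      · right; exact congrArg Subrepresentation.toSubmodule h
  · rintro ⟨hV, h⟩
    refine { exists_pair_ne := ⟨⊥, ⊤, ?_⟩, eq_bot_or_eq_top := ?_ }
    · intro he
      exact bot_ne_top (α := Submodule ℂ V) (congrArg Subrepresentation.toSubmodule he)
    · intro U
      rcases h U.toSubmodule (fun g v hv => U.apply_mem_toSubmodule g hv) with h | h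
      · left; exact Subrepresentation.toSubmodule_injective h
      · right; exact Subrepresentation.toSubmodule_injective h

theorem isIrreducible_of_equiv {ρ : Representation ℂ G V} {σ : Representation ℂ G W}
    (e : V ≃ₗ[ℂ] W) (he : ∀ g v, e (ρ g v) = σ g (e v)) (hρ : ρ.IsIrreducible) :
    σ.IsIrreducible := by
  rw [isIrreducible_iff_forall_submodule] at hρ ⊢
  obtain ⟨hV, h⟩ := hρ
  refine ⟨e.symm.toEquiv.nontrivial, fun U hU => ?_⟩
  have hU' : U = (U.comap e.toLinearMap).map e.toLinearMap :=
    (Submodule.map_comap_eq_of_surjective e.surjective U).symm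
  rcases h (U.comap e.toLinearMap) (fun g v hv => by
    simpa [he] using hU g _ hv) with h | h
  · left; rw [hU', h, Submodule.map_bot]
  · right; rw [hU', h, Submodule.map_top, LinearEquiv.range]

theorem isIrreducible_comp_mulEquiv {H : Type*} [Group H] {ρ : Representation ℂ G V}
    (hρ : ρ.IsIrreducible) (φ : H ≃* G) :
    IsIrreducible (ρ.comp φ.toMonoidHom : Representation ℂ H V) := by
  rw [isIrreducible_iff_forall_submodule] at hρ ⊢
  refine ⟨hρ.1, fun U hU => hρ.2 U fun g v hv => ?_⟩
  simpa using hU (φ.symm g) v hv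

theorem character_mem_Irr [FiniteDimensional ℂ V] {ρ : Representation ℂ G V}
    (hρ : ρ.IsIrreducible) : ρ.character ∈ Irr G := by
  let e : V ≃ₗ[ℂ] (Fin (finrank ℂ V) → ℂ) := (finBasis ℂ V).equivFun
  let σ : Representation ℂ G (Fin (finrank ℂ V) → ℂ) :=
    (e.conjAlgEquiv ℂ : _ →* _).comp ρ
  have hσ : ∀ g v, e (ρ g v) = σ g (e v) := fun g v => by
    simp [σ, LinearEquiv.conjAlgEquiv_apply]
  refine ⟨finrank ℂ V, σ, isIrreducible_of_equiv e hσ hρ, ?_⟩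
  ext g
  exact LinearMap.trace_conj' (ρ g) e

theorem comp_mulEquiv_mem_Irr {H : Type*} [Group H] {χ : G → ℂ} (hχ : χ ∈ Irr G) (φ : H ≃* G) :
    χ ∘ φ ∈ Irr H := by
  obtain ⟨n, ρ, hρ, rfl⟩ := hχ
  exact ⟨n, _, isIrreducible_comp_mulEquiv hρ φ, rfl⟩

end Transport

/-! ### Orthonormality and completeness of irreducible characters. -/

section Inner

variable {G : Type*} [Group G] [Fintype G]

/-- The symmetric bilinear form `|G|⁻¹ ∑ f(g) h(g⁻¹)` on functions on `G`. -/
noncomputable def charInner (f h : G → ℂ) : ℂ := (Nat.card G : ℂ)⁻¹ * ∑ g, f g * h g⁻¹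

theorem card_ne_zero_complex : (Nat.card G : ℂ) ≠ 0 := by
  exact_mod_cast Nat.card_pos.ne'

noncomputable instance : Invertible (Nat.card G : ℂ) := invertibleOfNonzero card_ne_zero_complex

theorem charInner_comm (f h : G → ℂ) : charInner f h = charInner h f := by
  unfold charInner
  congr 1
  refine Fintype.sum_equiv (Equiv.inv G) _ _ fun g => ?_
  simp [mul_comm]

theorem charInner_sub_left (f f' h : G → ℂ) :
    charInner (f - f') h = charInner f h - charInner f' h := by
  simp [charInner, sub_mul, mul_sub]

theorem charInner_sum_left {ι : Type*} (s : Finset ι) (c : ι → ℂ) (f : ι → G → ℂ) (h : G → ℂ) :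
    charInner (∑ i ∈ s, c i • f i) h = ∑ i ∈ s, c i * charInner (f i) h := by
  simp only [charInner, Finset.sum_apply, Pi.smul_apply, smul_eq_mul, Finset.sum_mul,
    Finset.mul_sum]
  rw [Finset.sum_comm]
  exact Finset.sum_congr rfl fun i _ => Finset.sum_congr rfl fun g _ => by ring

open Classical in
theorem charInner_eq_ite {χ χ' : G → ℂ} (hχ : χ ∈ Irr G) (hχ' : χ' ∈ Irr G) :
    charInner χ χ' = if χ = χ' then 1 else 0 := by
  obtain ⟨n, ρ, hρ, rfl⟩ := hχ
  obtain ⟨n', σ, hσ, rfl⟩ := hχ'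
  have key := char_orthonormal ρ σ
  have self := char_orthonormal ρ ρ
  rw [if_pos ⟨Representation.Equiv.refl ρ⟩] at self
  unfold charInner
  split_ifs with h
  · rw [← h, self]
  · rw [key, if_neg]
    rintro ⟨e⟩
    exact h (char_iso e).symm

theorem nonempty_equiv_of_character_eq {V W : Type*} [AddCommGroup V] [Module ℂ V]
    [FiniteDimensional ℂ V] [AddCommGroup W] [Module ℂ W] [FiniteDimensional ℂ W]
    {ρ : Representation ℂ G V} {σ : Representation ℂ G W} (hρ : ρ.IsIrreducible)
    (hσ : σ.IsIrreducible) (h : ρ.character = σ.character) : Nonempty (ρ.Equiv σ) := by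
  classical
  have key := char_orthonormal σ ρ
  have self := char_orthonormal σ σ
  rw [if_pos ⟨Representation.Equiv.refl σ⟩] at self
  rw [h, self] at key
  by_contra hne
  simp [hne] at key

theorem linearIndepOn_Irr : LinearIndepOn ℂ id (Irr G) := by
  classical
  rw [linearIndepOn_iff']
  intro s c hs h χ hχ
  have := congrArg (fun f => charInner f χ) h
  simp only [charInner_sum_left, id] at this
  rw [Finset.sum_congr rfl fun i hi => by rw [charInner_eq_ite (hs hi) (hs hχ)]] at this
  simpa [hχ, charInner] using this

theorem finite_Irr : (Irr G).Finite :=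
  (linearIndepOn_Irr (G := G)).setFinite

/-- A function on a group is a class function if it is constant on conjugacy classes. -/
def IsClassFun {H : Type*} [Group H] (f : H → ℂ) : Prop := ∀ x g, f (x * g * x⁻¹) = f g

theorem isClassFun_of_mem_Irr {G : Type*} [Group G] {χ : G → ℂ} (hχ : χ ∈ Irr G) :
    IsClassFun χ := by
  obtain ⟨n, ρ, -, rfl⟩ := hχ
  exact fun x g => ρ.char_conj g x

/-- The operator commutes with `ρ`, so it is a scalar by Schur, and its trace is a multiple of the
vanishing inner product. -/
theorem sum_smul_eq_zero_of_charInner_eq_zero {V : Type*} [AddCommGroup V] [Module ℂ V]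
    [FiniteDimensional ℂ V] {ρ : Representation ℂ G V} (hρ : ρ.IsIrreducible)
    {f : G → ℂ} (hf : IsClassFun f) (h : charInner f ρ.character = 0) :
    ∑ g, f g • ρ g⁻¹ = 0 := by
  have hcomm : ∀ x, (∑ g, f g • ρ g⁻¹) ∘ₗ ρ x = ρ x ∘ₗ (∑ g, f g • ρ g⁻¹) := by
    intro x
    change (∑ g, f g • ρ g⁻¹) * ρ x = ρ x * (∑ g, f g • ρ g⁻¹)
    rw [Finset.sum_mul, Finset.mul_sum]
    refine Fintype.sum_equiv (MulAut.conj x⁻¹).toEquiv _ _ fun g => ?_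
    simp only [MulEquiv.toEquiv_eq_coe, EquivLike.coe_coe, MulAut.conj_apply, hf x⁻¹ g,
      smul_mul_assoc, mul_smul_comm, ← map_mul]
    congr 2
    group
  obtain ⟨c, hc⟩ := (IsIrreducible.algebraMap_intertwiningMap_bijective_of_isAlgClosed
    (ρ := ρ)).2 ⟨∑ g, f g • ρ g⁻¹, hcomm⟩
  have hc' : ∑ g, f g • ρ g⁻¹ = c • LinearMap.id := by
    have := congrArg IntertwiningMap.toLinearMap hc
    exact this.symm.trans (by ext v; rfl)
  have htr := congrArg (LinearMap.trace ℂ V) hc'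
  have h0 : ∑ g, f g * ρ.character g⁻¹ = 0 := by
    simpa [charInner] using h
  have hV : Nontrivial V := ((isIrreducible_iff_forall_submodule ρ).1 hρ).1
  have : c = 0 := by
    simp only [map_sum, map_smul, LinearMap.trace_id] at htr
    have h1 : ∑ g, f g • LinearMap.trace ℂ V (ρ g⁻¹) = 0 := h0
    rw [h1] at htr
    have := finrank_pos (R := ℂ) (M := V)
    simpa [this.ne'] using htr.symm
  rw [hc', this, zero_smul]

/-- The group algebra element `z` with coefficients `f` kills every simple module, so it lies in the
Jacobson radical, which is zero by Maschke. -/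
theorem eq_zero_of_forall_charInner_eq_zero {f : G → ℂ} (hf : IsClassFun f)
    (h : ∀ χ ∈ Irr G, charInner f χ = 0) : f = 0 := by
  let z : ℂ[G] := ∑ g, f g • MonoidAlgebra.of ℂ G g⁻¹
  have hz : z = 0 := by
    have hJ : Ring.jacobson ℂ[G] = ⊥ := IsSemisimpleModule.jacobson_eq_bot ℂ[G] ℂ[G]
    have : z ∈ Ring.jacobson ℂ[G] := by
      rw [Ring.jacobson, Module.jacobson, Submodule.mem_sInf]
      intro I hI
      have hI' : IsCoatom I := hI
      rw [← isSimpleModule_iff_isCoatom] at hI'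
      let ρ : Representation ℂ G (ℂ[G] ⧸ I) := ofModule' (ℂ[G] ⧸ I)
      have hρg : ∀ g v, ρ g v = MonoidAlgebra.of ℂ G g • v := fun g v => rfl
      have hρ : ρ.IsIrreducible := by
        rw [isIrreducible_iff_forall_submodule]
        refine ⟨IsSimpleModule.nontrivial ℂ[G] _, fun U hU => ?_⟩
        let U' : Submodule ℂ[G] (ℂ[G] ⧸ I) :=
          { U with
            smul_mem' := fun r v hv => by
              induction r using MonoidAlgebra.induction_on with
              | of g => exact hU g v hv
              | add a b ha hb => rw [add_smul]; exact U.add_mem ha hb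
              | smul c a ha => rw [smul_assoc]; exact U.smul_mem c ha }
        rcases eq_bot_or_eq_top U' with h | h
        · left
          ext v
          exact (SetLike.ext_iff.1 h v)
        · right
          ext v
          exact (SetLike.ext_iff.1 h v)
      have := sum_smul_eq_zero_of_charInner_eq_zero hρ hf
        (h _ (character_mem_Irr hρ))
      have h1 := LinearMap.congr_fun this (Submodule.Quotient.mk 1)
      rw [← Submodule.Quotient.mk_eq_zero]
      have h2 : z • (Submodule.Quotient.mk 1 : ℂ[G] ⧸ I) = 0 := by
        simp only [z, Finset.sum_smul, smul_assoc]
        simpa only [hρg, LinearMap.sum_apply, LinearMap.smul_apply, LinearMap.zero_apply] using h1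
      rwa [← Submodule.Quotient.mk_smul, smul_eq_mul, mul_one] at h2
    rw [hJ] at this
    simpa using this
  classical
  ext g
  have := congrArg (fun z : ℂ[G] => z.coeff g⁻¹) hz
  simpa [z, Finsupp.single_apply] using this

theorem IsClassFun.eq_sum_charInner {f : G → ℂ} (hf : IsClassFun f) :
    f = ∑ χ ∈ (finite_Irr (G := G)).toFinset, charInner f χ • χ := by
  classical
  rw [← sub_eq_zero]
  apply eq_zero_of_forall_charInner_eq_zero
  · intro x g
    simp only [Pi.sub_apply, Finset.sum_apply, Pi.smul_apply, hf x g]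
    congr 1
    refine Finset.sum_congr rfl fun χ hχ => ?_
    rw [isClassFun_of_mem_Irr ((finite_Irr.mem_toFinset).1 hχ) x g]
  · intro χ hχ
    rw [charInner_sub_left, charInner_sum_left,
      Finset.sum_congr rfl fun i hi => by
        rw [charInner_eq_ite ((finite_Irr.mem_toFinset).1 hi) hχ]]
    simp [hχ]

end Inner

end FrobeniusTriple

namespace FrobeniusTriple

open Representation Module
open scoped MonoidAlgebra

/-! ### Kernels of characters. -/

section Kernel

variable {G V : Type*} [Group G] [Finite G] [AddCommGroup V] [Module ℂ V] [FiniteDimensional ℂ V]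

/-- The eigenvalues have modulus 1 and sum to the dimension, so all equal 1; the minimal polynomial
divides the squarefree `X ^ k - 1`, so it divides `X - 1`. -/
theorem end_eq_one_of_pow_eq_one_of_trace_eq {f : End ℂ V} {k : ℕ} (hk : k ≠ 0) (hf : f ^ k = 1)
    (htr : LinearMap.trace ℂ V f = finrank ℂ V) : f = 1 := by
  have hsplit : f.charpoly.Splits := IsAlgClosed.splits _
  have hnorm : ∀ μ ∈ f.charpoly.roots, ‖μ‖ = 1 := by
    intro μ hμ
    have hroot : f.charpoly.IsRoot μ := (Polynomial.mem_roots'.1 hμ).2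
    obtain ⟨v, hv⟩ := (End.hasEigenvalue_iff_isRoot_charpoly f μ).2 hroot |>.exists_hasEigenvector
    have h1 := hv.pow_apply k
    rw [hf, End.one_apply] at h1
    have h2 : (1 - μ ^ k) • v = 0 := by rw [sub_smul, one_smul, ← h1, sub_self]
    have h3 : μ ^ k = 1 := (sub_eq_zero.1 ((smul_eq_zero.1 h2).resolve_right hv.2)).symm
    exact Complex.norm_eq_one_of_pow_eq_one h3 hk
  have hcard : (Multiset.card f.charpoly.roots : ℂ) = finrank ℂ V := by
    rw [← LinearMap.charpoly_natDegree f, hsplit.natDegree_eq_card_roots]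
  have hsum : (f.charpoly.roots.map fun μ => 1 - μ.re).sum = 0 := by
    have h1 : (f.charpoly.roots.map Complex.re).sum = Multiset.card f.charpoly.roots := by
      have h2 := (End.trace_eq_sum_roots_charpoly_of_splits hsplit).symm.trans
        (htr.trans hcard.symm)
      have h3 := congrArg Complex.reAddGroupHom h2
      rw [map_multiset_sum] at h3
      simpa using h3
    rw [Multiset.sum_map_sub, h1]
    simp
  have hroots : ∀ μ ∈ f.charpoly.roots, μ = 1 := by
    intro μ hμ
    have hle : ∀ x ∈ f.charpoly.roots.map fun μ => 1 - μ.re, 0 ≤ x := by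
      intro x hx
      obtain ⟨ν, hν, rfl⟩ := Multiset.mem_map.1 hx
      have := Complex.re_le_norm ν
      rw [hnorm ν hν] at this
      linarith
    have h0 := Multiset.all_zero_of_le_zero_le_of_sum_eq_zero hle hsum _
      (Multiset.mem_map_of_mem (fun μ : ℂ => 1 - μ.re) hμ)
    have hre : μ.re = 1 := by linarith
    have hn := Complex.sq_norm μ
    rw [hnorm μ hμ, Complex.normSq_apply, hre] at hn
    apply Complex.ext
    · simpa using hre
    · have : μ.im * μ.im = 0 := by linarith
      simpa using this
  have hchar : f.charpoly = (Polynomial.X - Polynomial.C 1) ^ (Multiset.card f.charpoly.roots) := by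
    conv_lhs => rw [hsplit.eq_prod_roots_of_monic (LinearMap.charpoly_monic f),
      Multiset.eq_replicate_card.2 hroots]
    simp
  have hmin : minpoly ℂ f ∣ Polynomial.X ^ k - 1 := minpoly.dvd _ _ (by simp [hf])
  have hsq : Squarefree (minpoly ℂ f) := by
    refine Squarefree.squarefree_of_dvd hmin (Polynomial.Separable.squarefree ?_)
    exact (Polynomial.X_pow_sub_one_separable_iff).2 (by exact_mod_cast hk)
  -- The extra 1 keeps the exponent nonzero even when `V = 0`.
  have hdvd : minpoly ℂ f ∣ (Polynomial.X - Polynomial.C 1) ^ (Multiset.card f.charpoly.roots + 1) :=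
    (minpoly.dvd _ _ (by rw [← hchar]; exact LinearMap.aeval_self_charpoly f)).trans
      (pow_dvd_pow _ (Nat.le_succ _))
  rw [hsq.dvd_pow_iff_dvd (Nat.succ_ne_zero _)] at hdvd
  have := Polynomial.aeval_eq_zero_of_dvd_aeval_eq_zero hdvd (minpoly.aeval ℂ f)
  simpa [sub_eq_zero] using this

theorem character_eq_character_one_iff (ρ : Representation ℂ G V) (g : G) :
    ρ.character g = ρ.character 1 ↔ ρ g = 1 := by
  constructor
  · intro h
    refine end_eq_one_of_pow_eq_one_of_trace_eq (orderOf_pos g).ne' ?_ (h.trans ρ.char_one)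
    rw [← map_pow, pow_orderOf_eq_one, map_one]
  · intro h
    rw [character, character, h, ρ.map_one]

/-- The kernel of an irreducible character is that of a representation affording it. -/
theorem exists_subgroup_eq_charKer {χ : G → ℂ} (hχ : χ ∈ Irr G) :
    ∃ K : Subgroup G, (K : Set G) = charKer χ ∧ ∀ k ∈ K, ∀ g, χ (g * k) = χ g := by
  obtain ⟨n, ρ, -, rfl⟩ := hχ
  refine ⟨MonoidHom.ker ρ, ?_, fun k hk g => ?_⟩
  · ext g
    exact (character_eq_character_one_iff ρ g).symm
  · have hk' : ρ k = 1 := hk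
    rw [character, character, map_mul, hk', mul_one]

end Kernel

/-! ### Operators of an irreducible representation. -/

section Irreducible

variable {H V : Type*} [Group H] [AddCommGroup V] [Module ℂ V] {ρ : Representation ℂ H V}

/-- The sum maps into the `M`-fixed vectors, which form an invariant subspace because `M` is normal,
and a proper one by `hM`. -/
theorem sum_normal_eq_zero (hρ : ρ.IsIrreducible) (M : Subgroup H) [M.Normal] [Fintype M]
    (hM : ∃ m ∈ M, ρ m ≠ 1) : ∑ m : M, ρ m = 0 := by
  let U : Submodule ℂ V :=
    { carrier := {v | ∀ m ∈ M, ρ m v = v}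
      add_mem' := fun {a b} ha hb m hm => by rw [map_add, ha m hm, hb m hm]
      zero_mem' := fun m _ => map_zero _
      smul_mem' := fun c v hv m hm => by rw [map_smul, hv m hm] }
  have hU : ∀ g, ∀ v ∈ U, ρ g v ∈ U := by
    intro g v hv m hm
    have h1 := hv (g⁻¹ * m * g⁻¹⁻¹) (‹M.Normal›.conj_mem m hm g⁻¹)
    have h2 : m * g = g * (g⁻¹ * m * g⁻¹⁻¹) := by group
    rw [← End.mul_apply, ← map_mul, h2, map_mul, End.mul_apply, h1]
  rcases ((isIrreducible_iff_forall_submodule ρ).1 hρ).2 U hU with h | h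
  · ext v
    have : (∑ m : M, ρ m) v ∈ U := by
      intro m hm
      rw [LinearMap.sum_apply, map_sum]
      refine Fintype.sum_equiv (Equiv.mulLeft ⟨m, hm⟩) _ _ fun x => ?_
      simp
    rw [h] at this
    simpa using this
  · obtain ⟨m, hm, hne⟩ := hM
    refine absurd (LinearMap.ext fun v => ?_) hne
    have : v ∈ U := h ▸ Submodule.mem_top
    exact this m hm

/-- The operators of an irreducible representation separate endomorphisms under the trace form. -/
theorem eq_zero_of_forall_trace_mul_eq_zero [FiniteDimensional ℂ V] (hρ : ρ.IsIrreducible)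
    {S : End ℂ V} (hS : ∀ h, LinearMap.trace ℂ V (S * ρ h) = 0) : S = 0 := by
  have hsimple : IsSimpleModule ℂ[H] ρ.asModule := (irreducible_iff_isSimpleModule_asModule ρ).1 hρ
  have hall : ∀ r : ℂ[H], LinearMap.trace ℂ V (S * ρ.asAlgebraHom r) = 0 := by
    intro r
    induction r using MonoidAlgebra.induction_on with
    | of g => rw [asAlgebraHom_of]; exact hS g
    | add a b ha hb => rw [map_add, mul_add, map_add, ha, hb, add_zero]
    | smul c a ha => rw [map_smul, mul_smul_comm, map_smul, ha, smul_zero]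
  classical
  -- Burnside's theorem: by Schur the commutant is scalar, so every `T` commutes with it, and
  -- Jacobson density realizes `T` on a basis.
  have hsurj : ∀ T : End ℂ V, ∃ r : ℂ[H], ρ.asAlgebraHom r = T := by
    intro T
    let f : End (End ℂ[H] ρ.asModule) ρ.asModule :=
      { toFun := fun v => T v
        map_add' := fun v w => T.map_add v w
        map_smul' := fun a v => by
          obtain ⟨c, rfl⟩ := (IsSimpleModule.algebraMap_end_bijective_of_isAlgClosed
            (A := ℂ[H]) (V := ρ.asModule) ℂ).2 a
          exact T.map_smul c v }
    let b := finBasis ℂ V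
    obtain ⟨r, hr⟩ := jacobson_density (R := ℂ[H]) (M := ρ.asModule) f
      (Finset.univ.image b)
    refine ⟨r, b.ext fun i => ?_⟩
    exact (hr (b i) (Finset.mem_image_of_mem _ (Finset.mem_univ i))).symm
  ext v
  rw [LinearMap.zero_apply, ← Module.forall_dual_apply_eq_zero_iff ℂ]
  intro φ
  -- Testing `S` against the rank-one operator `w ↦ φ w • v` gives trace `φ (S v)`.
  obtain ⟨r, hr⟩ := hsurj (φ.smulRight v)
  have := hall r
  rw [hr] at this
  have h2 : S * φ.smulRight v = φ.smulRight (S v) := by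
    ext w; simp
  rw [h2] at this
  simpa using this

end Irreducible

/-! ### Fixed-point-free commutation forces small stabilizers. -/

section Inertia

variable {G : Type*} [Group G] [Fintype G] {N : Subgroup G} [N.Normal]

theorem inertia_le_of_forall_commute_eq_one {M : Subgroup G} [M.Normal] (hMN : M ≤ N)
    (hM : ∀ g ∉ N, ∀ x ∈ M, g * x = x * g → x = 1) {ψ : N → ℂ} (hψ : ψ ∈ IrrOver N M) :
    inertia ψ ≤ N := by
  classical
  obtain ⟨⟨k, ρ, hρ, rfl⟩, hker⟩ := hψ
  intro g hg
  by_contra hgN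
  obtain ⟨e⟩ := nonempty_equiv_of_character_eq hρ
    (isIrreducible_comp_mulEquiv hρ (MulAut.conjNormal g : N ≃* N))
    (funext fun n => (hg n).symm)
  let S : End ℂ (Fin k → ℂ) := e.toLinearEquiv.toLinearMap
  have hSρ : ∀ n : N, S * ρ n = ρ (MulAut.conjNormal g n) * S := fun n => e.isIntertwining' n
  let M' : Subgroup N := M.subgroupOf N
  have hMne : ∃ m ∈ M', ρ m ≠ 1 := by
    obtain ⟨m, hm, hm'⟩ := Set.not_subset.1 hker
    refine ⟨⟨m, hMN hm⟩, hm, fun h1 => hm' ⟨⟨m, hMN hm⟩, ?_, rfl⟩⟩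
    exact (character_eq_character_one_iff ρ _).2 h1
  have hsum := sum_normal_eq_zero hρ M' hMne
  have htr : ∀ n : N, LinearMap.trace ℂ _ (S * ρ n) = 0 := by
    intro n
    have hy : g * n ∉ N := fun h => hgN ((N.mul_mem_cancel_right n.2).1 h)
    have htmem : ∀ m : M', ((g * n)⁻¹ * (m : N) * (g * n) * (m : N)⁻¹ : G) ∈ M := by
      intro m
      have h1 := ‹M.Normal›.conj_mem _ m.2 (g * n)⁻¹
      rw [inv_inv] at h1
      exact M.mul_mem h1 (M.inv_mem m.2)
    -- If `t m = t m'`, then `m'⁻¹ m` commutes with `g n ∉ N`, hence is trivial; so `t` permutes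
    -- `M'`.
    let t : M' → M' := fun m =>
      ⟨⟨(g * n)⁻¹ * (m : N) * (g * n) * (m : N)⁻¹, hMN (htmem m)⟩, htmem m⟩
    have htinj : Function.Injective t := by
      intro m m' hmm
      have h1 : ((g * n)⁻¹ * (m : N) * (g * n) * (m : N)⁻¹ : G) =
          (g * n)⁻¹ * (m' : N) * (g * n) * (m' : N)⁻¹ := congrArg (fun x : M' => ((x : N) : G)) hmm
      have h2 := hM (g * n) hy (((m' : N) : G)⁻¹ * (m : N))
        (M.mul_mem (M.inv_mem m'.2) m.2) (by
          have h3 : ((m : N) : G) * (g * n) =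
            (m' : N) * (g * n) * (m' : N)⁻¹ * (m : N) := by
            have := congrArg (fun z : G => (g * n) * z * (m : N)) h1
            simpa [mul_assoc] using this
          have h4 := congrArg (fun z : G => ((m' : N) : G)⁻¹ * z) h3
          simp only [mul_assoc, inv_mul_cancel_left] at h4 ⊢
          exact h4.symm)
      exact Subtype.ext (Subtype.ext (inv_mul_eq_one.1 h2).symm)
    have htbij : Function.Bijective t := Finite.injective_iff_bijective.1 htinj
    -- `S * ρ n` behaves like an operator for `g n`: multiplying it by `ρ (t m)` amounts to
    -- conjugating it by `ρ m`, which preserves the trace.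
    have hconst : ∀ m : M', LinearMap.trace ℂ _ (S * ρ n * ρ (t m)) =
        LinearMap.trace ℂ _ (S * ρ n) := by
      intro m
      have h1 : n * (t m : N) = MulAut.conjNormal g⁻¹ (m : N) * n * (m : N)⁻¹ := by
        apply Subtype.ext
        simp [t, mul_assoc]
      have h2 : S * ρ n * ρ (t m) = ρ (m : N) * (S * ρ n) * ρ (m : N)⁻¹ := by
        rw [mul_assoc, ← ρ.map_mul, h1, ρ.map_mul, ρ.map_mul, ← mul_assoc, ← mul_assoc, hSρ,
          ← MulAut.mul_apply, ← map_mul, mul_inv_cancel, map_one, MulAut.one_apply]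
        simp only [mul_assoc]
      rw [h2, LinearMap.trace_mul_comm, ← mul_assoc, ← ρ.map_mul, inv_mul_cancel, ρ.map_one,
        one_mul]
    have h0 : ∑ m : M', LinearMap.trace ℂ _ (S * ρ n * ρ (t m)) = 0 := by
      rw [htbij.sum_comp (fun m : M' => LinearMap.trace ℂ _ (S * ρ n * ρ m)), ← map_sum, ← Finset.mul_sum, hsum,
        mul_zero, map_zero]
    rw [Finset.sum_congr rfl fun m _ => hconst m, Finset.sum_const, nsmul_eq_mul] at h0
    refine (mul_eq_zero.1 h0).resolve_left ?_
    simp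
  have hS0 := eq_zero_of_forall_trace_mul_eq_zero hρ htr
  have := ((isIrreducible_iff_forall_submodule ρ).1 hρ).1
  obtain ⟨v, hv⟩ := exists_ne (0 : Fin k → ℂ)
  refine hv (e.toLinearEquiv.injective ?_)
  rw [map_zero]
  exact LinearMap.congr_fun hS0 v

end Inertia

end FrobeniusTriple

namespace FrobeniusTriple

open Representation Module

/-! ### Conjugates and restrictions of characters. -/

section Restriction

variable {G : Type*} [Group G] {N : Subgroup G}

theorem conj_mem_Irr [N.Normal] {ψ : N → ℂ} (hψ : ψ ∈ Irr N) (g : G) :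
    (fun n => ψ (MulAut.conjNormal g n)) ∈ Irr N :=
  comp_mulEquiv_mem_Irr hψ (MulAut.conjNormal g : N ≃* N)

theorem le_inertia [N.Normal] {ψ : N → ℂ} (hψ : ψ ∈ Irr N) : N ≤ inertia ψ := by
  intro g hg n
  have := isClassFun_of_mem_Irr hψ ⟨g, hg⟩ n
  exact this

/-- The value is the dimension of a space of intertwining maps. -/
theorem charInner_restrict_mem_nat [Fintype N] {ψ : N → ℂ} (hψ : ψ ∈ Irr N) {χ : G → ℂ}
    (hχ : χ ∈ Irr G) : ∃ m : ℕ, charInner ψ (fun n : N => χ n) = m := by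
  obtain ⟨k, ρ, -, rfl⟩ := hψ
  obtain ⟨l, σ, -, rfl⟩ := hχ
  exact ⟨_, card_inv_mul_sum_char_mul_char_eq_finrank
    (σ.comp N.subtype : Representation ℂ N (Fin l → ℂ)) ρ⟩

end Restriction

/-! ### Induced characters and conjugacy off `N`. -/

section Induction

variable {G : Type*} [Group G] [Fintype G] {N : Subgroup G}

theorem isClassFun_indChar (ψ : N → ℂ) : IsClassFun (indChar N ψ) := by
  intro y g
  simp only [indChar]
  congr 1
  refine Fintype.sum_equiv (Equiv.mulRight y) _ _ fun x => ?_
  have h : Equiv.mulRight y x * g * (Equiv.mulRight y x)⁻¹ = x * (y * g * y⁻¹) * x⁻¹ := by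
    simp [mul_assoc]
  rw [h]

theorem indChar_of_notMem [N.Normal] (ψ : N → ℂ) {g : G} (hg : g ∉ N) : indChar N ψ g = 0 := by
  simp only [indChar]
  rw [Finset.sum_eq_zero, mul_zero]
  intro x _
  rw [dif_neg]
  exact fun h => hg (by simpa [mul_assoc] using ‹N.Normal›.conj_mem _ h x⁻¹)

theorem indChar_coe [N.Normal] (ψ : N → ℂ) (n : N) :
    indChar N ψ n = (Nat.card N : ℂ)⁻¹ * ∑ x : G, ψ (MulAut.conjNormal x n) := by
  simp only [indChar]
  congr 1
  refine Finset.sum_congr rfl fun x _ => ?_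
  rw [dif_pos (‹N.Normal›.conj_mem _ n.2 x)]
  rfl

/-- Frobenius reciprocity. -/
theorem charInner_indChar [Fintype N] (ψ : N → ℂ) {χ : G → ℂ} (hχ : IsClassFun χ) :
    charInner (indChar N ψ) χ = charInner ψ (fun n : N => χ n) := by
  classical
  have hsum : ∀ x : G, ∑ g : G, (if h : x * g * x⁻¹ ∈ N then ψ ⟨x * g * x⁻¹, h⟩ else 0) * χ g⁻¹ =
      ∑ n : N, ψ n * χ (n : G)⁻¹ := by
    intro x
    symm
    refine Fintype.sum_of_injective (fun n : N => x⁻¹ * n * x)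
      (fun a b hab => Subtype.ext (by simpa using hab)) _ _ (fun g hg => ?_) (fun n => ?_)
    · rw [dif_neg, zero_mul]
      exact fun h => hg ⟨⟨_, h⟩, by simp [mul_assoc]⟩
    · have h1 : x * (x⁻¹ * n * x) * x⁻¹ = n := by group
      have h2 : χ (x⁻¹ * n * x)⁻¹ = χ (n : G)⁻¹ := by
        rw [← hχ x⁻¹ (n : G)⁻¹]
        congr 1
        group
      simp only [h1, h2, SetLike.coe_mem, dif_pos]
  simp only [charInner, indChar]
  have h1 : ∀ g : G, ((Nat.card N : ℂ)⁻¹ *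
      ∑ x : G, if h : x * g * x⁻¹ ∈ N then ψ ⟨x * g * x⁻¹, h⟩ else 0) * χ g⁻¹ =
      (Nat.card N : ℂ)⁻¹ *
        ∑ x : G, (if h : x * g * x⁻¹ ∈ N then ψ ⟨x * g * x⁻¹, h⟩ else 0) * χ g⁻¹ := by
    intro g
    rw [mul_assoc, Finset.sum_mul]
  rw [Finset.sum_congr rfl fun g _ => h1 g, ← Finset.mul_sum, Finset.sum_comm,
    Finset.sum_congr rfl fun x _ => hsum x, Finset.sum_const, nsmul_eq_mul, Finset.card_univ,
    ← Nat.card_eq_fintype_card]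
  have := card_ne_zero_complex (G := G)
  field_simp
  simp

/-- By reciprocity, `ψ` is paired with the average of its conjugates; the conjugate by `x`
contributes exactly when `x` stabilizes `ψ`. -/
theorem charInner_indChar_self [N.Normal] [Fintype N] {ψ : N → ℂ} (hψ : ψ ∈ Irr N) :
    charInner (indChar N ψ) (indChar N ψ) = (Nat.card N : ℂ)⁻¹ * Nat.card (inertia ψ) := by
  classical
  rw [charInner_indChar ψ (isClassFun_indChar ψ), charInner_comm]
  have h1 : (fun n : N => indChar N ψ n) =
      ∑ x : G, (Nat.card N : ℂ)⁻¹ • fun n => ψ (MulAut.conjNormal x n) := by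
    ext n
    rw [indChar_coe, Finset.mul_sum]
    simp
  rw [h1, charInner_sum_left, ← Finset.mul_sum]
  congr 1
  have h2 : ∀ x : G, charInner (fun n => ψ (MulAut.conjNormal x n)) ψ =
      if x ∈ inertia ψ then 1 else 0 := by
    intro x
    rw [charInner_eq_ite (conj_mem_Irr hψ x) hψ]
    exact if_congr funext_iff rfl rfl
  rw [Finset.sum_congr rfl fun x _ => h2 x, Finset.sum_boole, Nat.card_eq_fintype_card,
    Fintype.card_subtype]

/-- An irreducible character of a normal subgroup induces irreducibly if and only if it is not
invariant under any larger subgroup. -/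
theorem indChar_mem_Irr_iff [N.Normal] {ψ : N → ℂ} (hψ : ψ ∈ Irr N) :
    indChar N ψ ∈ Irr G ↔ inertia ψ = N := by
  classical
  have hself := charInner_indChar_self hψ
  have hN := card_ne_zero_complex (G := N)
  constructor
  · intro h
    rw [charInner_eq_ite h h, if_pos rfl, eq_comm, inv_mul_eq_one₀ hN] at hself
    exact (Subgroup.eq_of_le_of_card_ge (le_inertia hψ) (Nat.cast_injective hself).ge).symm
  · intro h
    rw [h, inv_mul_cancel₀ hN] at hself
    have hexp := (isClassFun_indChar ψ).eq_sum_charInner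
    have hnat : ∀ χ : G → ℂ, ∃ m : ℕ, χ ∈ Irr G → charInner (indChar N ψ) χ = m := by
      intro χ
      by_cases hχ : χ ∈ Irr G
      · obtain ⟨m, hm⟩ := charInner_restrict_mem_nat hψ hχ
        exact ⟨m, fun _ => by rw [charInner_indChar ψ (isClassFun_of_mem_Irr hχ), hm]⟩
      · exact ⟨0, fun h => absurd h hχ⟩
    choose m hm using hnat
    have hmem : ∀ χ ∈ (finite_Irr (G := G)).toFinset, χ ∈ Irr G :=
      fun χ hχ => (finite_Irr.mem_toFinset).1 hχ
    have hexp' : indChar N ψ = ∑ χ ∈ (finite_Irr (G := G)).toFinset, (m χ : ℂ) • χ :=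
      hexp.trans (Finset.sum_congr rfl fun χ hχ => by rw [hm χ (hmem χ hχ)])
    -- Squares of natural multiplicities summing to 1 leave one constituent, of multiplicity 1.
    have hsq : ∑ χ ∈ (finite_Irr (G := G)).toFinset, m χ * m χ = 1 := by
      have h1 : charInner (indChar N ψ) (indChar N ψ) =
          ∑ χ ∈ (finite_Irr (G := G)).toFinset, (m χ : ℂ) * m χ := by
        conv_lhs => arg 1; rw [hexp']
        rw [charInner_sum_left]
        refine Finset.sum_congr rfl fun χ hχ => ?_
        rw [charInner_comm, hm χ (hmem χ hχ)]
      rw [hself] at h1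
      exact_mod_cast h1.symm
    obtain ⟨χ, hχ, hχne⟩ := Finset.exists_ne_zero_of_sum_ne_zero (hsq.trans_ne one_ne_zero)
    rw [← Finset.add_sum_erase _ _ hχ] at hsq
    have hpos : 0 < m χ * m χ := Nat.pos_of_ne_zero hχne
    have hm1 : m χ = 1 := by
      have : m χ * m χ = 1 := by omega
      simpa using this
    have hχ0 : ∑ χ' ∈ (finite_Irr (G := G)).toFinset.erase χ, m χ' * m χ' = 0 := by omega
    rw [hexp', Finset.sum_eq_single_of_mem χ hχ, hm1, Nat.cast_one, one_smul]
    · exact hmem χ hχ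
    · intro χ' hχ' hne
      have : m χ' = 0 := by
        simpa using Finset.sum_eq_zero_iff.1 hχ0 χ' (Finset.mem_erase.2 ⟨hne, hχ'⟩)
      rw [this, Nat.cast_zero, zero_smul]

/-- The indicator of the class of `a` is a combination of irreducible characters. -/
theorem isConj_of_forall_Irr_eq {a b : G} (h : ∀ χ ∈ Irr G, χ a = χ b) : IsConj a b := by
  classical
  let f : G → ℂ := fun g => if IsConj a g then 1 else 0
  have hf : IsClassFun f := by
    intro x g
    have : IsConj g (x * g * x⁻¹) := isConj_iff.2 ⟨x, rfl⟩
    exact if_congr ⟨fun h => h.trans this.symm, fun h => h.trans this⟩ rfl rfl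
  have hexp := hf.eq_sum_charInner
  have hab : f a = f b := by
    rw [hexp]
    simp only [Finset.sum_apply, Pi.smul_apply]
    exact Finset.sum_congr rfl fun χ hχ => by rw [h χ ((finite_Irr.mem_toFinset).1 hχ)]
  by_contra hne
  rw [show f a = 1 from if_pos (IsConj.refl a), show f b = 0 from if_neg hne] at hab
  exact one_ne_zero hab

/-- If the restriction of `χ` to `N` has a constituent in `IrrOver N M`, then `χ` is induced from
it. Otherwise every constituent is trivial on `M`. -/
theorem subset_charKer_or_eq_zero_of_notMem [N.Normal] {M : Subgroup G} (hMN : M ≤ N)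
    (hM : ∀ ψ ∈ IrrOver N M, indChar N ψ ∈ Irr G) {χ : G → ℂ} (hχ : χ ∈ Irr G) :
    (∀ m ∈ M, χ m = χ 1) ∨ ∀ g ∉ N, χ g = 0 := by
  classical
  by_cases h : ∃ ψ ∈ IrrOver N M, charInner ψ (fun n : N => χ n) ≠ 0
  · obtain ⟨ψ, hψ, hne⟩ := h
    right
    rw [← charInner_indChar ψ (isClassFun_of_mem_Irr hχ), charInner_eq_ite (hM ψ hψ) hχ] at hne
    have : indChar N ψ = χ := by simpa using hne
    intro g hg
    rw [← this, indChar_of_notMem ψ hg]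
  · left
    push Not at h
    have hcl : IsClassFun (fun n : N => χ n) := fun x g => by
      simpa using isClassFun_of_mem_Irr hχ x g
    intro m hm
    have key : (fun n : N => χ n) ⟨m, hMN hm⟩ = (fun n : N => χ n) 1 := by
      rw [hcl.eq_sum_charInner]
      simp only [Finset.sum_apply, Pi.smul_apply]
      refine Finset.sum_congr rfl fun ψ hψ => ?_
      have hψ' : ψ ∈ Irr N := (finite_Irr.mem_toFinset).1 hψ
      by_cases hker : (M : Set G) ⊆ Subtype.val '' charKer ψ
      · obtain ⟨n, hn, hnm⟩ := hker hm
        have : n = ⟨m, hMN hm⟩ := Subtype.ext hnm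
        subst this
        rw [show ψ ⟨m, hMN hm⟩ = ψ 1 from hn]
      · rw [charInner_comm, h ψ ⟨hψ', hker⟩, zero_smul, zero_smul]
    simpa using key

theorem isConj_mul_of_notMem [N.Normal] {M : Subgroup G} (hMN : M ≤ N)
    (hM : ∀ ψ ∈ IrrOver N M, indChar N ψ ∈ Irr G) {a x : G} (ha : a ∉ N) (hx : x ∈ M) :
    IsConj a (a * x) := by
  refine isConj_of_forall_Irr_eq fun χ hχ => ?_
  rcases subset_charKer_or_eq_zero_of_notMem hMN hM hχ with h | h
  · obtain ⟨K, hK, hK'⟩ := exists_subgroup_eq_charKer hχ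
    have : x ∈ (K : Set G) := hK ▸ h x hx
    rw [hK' x this]
  · rw [h a ha, h (a * x) fun hax => ha ((N.mul_mem_cancel_right (hMN hx)).1 hax)]

end Induction

end FrobeniusTriple

namespace FrobeniusTriple

/-! ### The largest normal `π`-subgroup. -/

section PiCore

variable {G : Type*} [Group G]

theorem primesOf_subset_of_le {π : Set ℕ} {H K : Subgroup G} (h : H ≤ K) (hK : primesOf K ⊆ π) :
    primesOf H ⊆ π :=
  fun _ hp => hK ⟨hp.1, hp.2.trans (Subgroup.card_dvd_of_le h)⟩

/-- `|HK| = |H| · |K : H ∩ K|`. -/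
theorem supClosed_normal_piSubgroup (π : Set ℕ) :
    SupClosed {K : Subgroup G | K.Normal ∧ primesOf K ⊆ π} := by
  rintro H ⟨hH, hHπ⟩ K ⟨hK, hKπ⟩
  refine ⟨Subgroup.sup_normal H K, fun p ⟨hp, hdvd⟩ => ?_⟩
  have h1 := Subgroup.relIndex_mul_relIndex ⊥ H (H ⊔ K) bot_le le_sup_left
  rw [Subgroup.relIndex_bot_left, Subgroup.relIndex_bot_left, sup_comm,
    Subgroup.relIndex_sup_right, sup_comm] at h1
  rw [← h1, hp.dvd_mul] at hdvd
  rcases hdvd with h | h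
  · exact hHπ ⟨hp, h⟩
  · exact hKπ ⟨hp, h.trans (Subgroup.relIndex_dvd_card H K)⟩

variable [Finite G]

theorem piCore_mem (π : Set ℕ) :
    piCore π G ∈ {K : Subgroup G | K.Normal ∧ primesOf K ⊆ π} := by
  refine (supClosed_normal_piSubgroup π).sSup_mem (Set.toFinite _) ?_ subset_rfl
  refine ⟨Subgroup.normal_bot, fun p ⟨hp, hdvd⟩ => ?_⟩
  rw [Subgroup.card_bot] at hdvd
  exact absurd hdvd hp.not_dvd_one

theorem le_piCore_iff {π : Set ℕ} {M : Subgroup G} (hM : M.Normal) :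
    M ≤ piCore π G ↔ primesOf M ⊆ π :=
  ⟨fun h => primesOf_subset_of_le h (piCore_mem π).2, fun h => le_sSup ⟨hM, h⟩⟩

end PiCore

/-! ### Centralizers of elements of `M`. -/

section CentGen

variable {G : Type*} [Group G] {M N : Subgroup G}

theorem centGen_le_iff :
    centGen M ≤ N ↔ ∀ g ∉ N, ∀ x ∈ M, g * x = x * g → x = 1 := by
  rw [centGen, iSup₂_le_iff]
  constructor
  · intro h g hg x hx hgx
    by_contra hx1
    exact hg (h x ⟨hx, hx1⟩ (Subgroup.mem_centralizer_singleton_iff.2 hgx))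
  · intro h x hx g hgx
    by_contra hg
    exact hx.2 (h g hg x hx.1 (Subgroup.mem_centralizer_singleton_iff.1 hgx))

theorem le_of_centGen_le (h : centGen M ≤ N) : M ≤ N := by
  intro x hx
  by_contra hxN
  exact hxN (centGen_le_iff.1 h x hxN x hx rfl ▸ N.one_mem)

theorem centGen_mono {K : Subgroup G} (h : M ≤ K) (hK : centGen K ≤ N) : centGen M ≤ N :=
  centGen_le_iff.2 fun g hg x hx => centGen_le_iff.1 hK g hg x (h hx)

variable [Finite G] [N.Normal]

/-- If `p` divides `|M|`, a Sylow `p`-subgroup of `G` acting on `M` fixes some `x ≠ 1`; it then lies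
in `N`, so `p` does not divide `|G : N|`. -/
theorem primesOf_subset_of_centGen_le (hM : M.Normal) (h : centGen M ≤ N) :
    primesOf M ⊆ (primesOf (G ⧸ N))ᶜ := by
  rintro p ⟨hp, hdvd⟩ ⟨-, hdvd'⟩
  have : Fact p.Prime := ⟨hp⟩
  let P : Sylow p G := default
  let act : MulAction P M :=
    MulAction.compHom M ((MulAut.conjNormal (H := M)).comp P.toSubgroup.subtype)
  have hfix : (1 : M) ∈ MulAction.fixedPoints P M := fun g =>
    map_one (MulAut.conjNormal (g : G) : MulAut M)
  obtain ⟨x, hx, hne⟩ :=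
    P.isPGroup'.exists_fixed_point_of_prime_dvd_card_of_fixed_point M hdvd hfix
  have hPN : (P : Subgroup G) ≤ N := by
    intro g hg
    by_contra hgN
    have h1 : g * x * g⁻¹ = x := by
      have h2 : MulAut.conjNormal g x = x := hx ⟨g, hg⟩
      simpa using congrArg Subtype.val h2
    refine hne (Subtype.ext ?_)
    exact (centGen_le_iff.1 h g hgN x x.2 (mul_inv_eq_iff_eq_mul.1 h1)).symm
  exact P.not_dvd_index (hdvd'.trans (Subgroup.index_dvd_of_le hPN))

/-- For a prime `p` dividing the order of `gN`, raising `g` to the `p'`-part of its order leaves a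
`p`-element still outside `N`. -/
theorem exists_pow_notMem {g : G} (hg : g ∉ N) :
    ∃ p ∈ primesOf (G ⧸ N), ∃ k j : ℕ, g ^ k ∉ N ∧ (g ^ k) ^ p ^ j = 1 := by
  have h1 : orderOf (g : G ⧸ N) ≠ 1 := by
    rwa [Ne, orderOf_eq_one_iff, QuotientGroup.eq_one_iff]
  obtain ⟨p, hp, hdvd⟩ := Nat.exists_prime_and_dvd h1
  refine ⟨p, ⟨hp, hdvd.trans (orderOf_dvd_natCard _)⟩, ordCompl[p] (orderOf g),
    (orderOf g).factorization p, fun h => ?_, ?_⟩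
  · rw [← QuotientGroup.eq_one_iff, QuotientGroup.mk_pow] at h
    exact Nat.not_dvd_ordCompl hp (orderOf_pos g).ne' (hdvd.trans (orderOf_dvd_of_pow_eq_one h))
  · rw [← pow_mul, mul_comm, Nat.ordProj_mul_ordCompl_eq_self, pow_orderOf_eq_one]

end CentGen

/-! ### The character criterion and the two descriptions of `frobI N`. -/

section Main

section

variable {G : Type*} [Group G] {N : Subgroup G}

theorem frobI_normal (N : Subgroup G) : (frobI N).Normal :=
  Subgroup.sSup_normal _ fun _ h => h.1

theorem lt_inertia_conj [N.Normal] {ψ : N → ℂ} (hψ : N < inertia ψ) (g : G) :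
    N < inertia (fun n => ψ (MulAut.conjNormal g n)) := by
  rw [SetLike.lt_iff_le_and_exists] at hψ ⊢
  have key : ∀ a, a ∈ inertia ψ → g⁻¹ * a * g ∈ inertia (fun n => ψ (MulAut.conjNormal g n)) := by
    intro a ha n
    change ψ _ = ψ _
    have h1 : MulAut.conjNormal g (MulAut.conjNormal (g⁻¹ * a * g) n) =
        MulAut.conjNormal a (MulAut.conjNormal g n) := by
      rw [← MulAut.mul_apply, ← MulAut.mul_apply, ← map_mul, ← map_mul]
      congr 2
      group
    rw [h1, ha]
  obtain ⟨hle, a, ha, haN⟩ := hψ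
  refine ⟨fun n hn => ?_, g⁻¹ * a * g, key a ha, fun h => haN ?_⟩
  · have := key _ (hle (‹N.Normal›.conj_mem n hn g))
    simpa [mul_assoc] using this
  · simpa [mul_assoc] using ‹N.Normal›.conj_mem _ h g

theorem exists_subgroup_eq_image_charKer [Finite G] {ψ : N → ℂ} (hψ : ψ ∈ Irr N) :
    ∃ K : Subgroup G, (K : Set G) = Subtype.val '' charKer ψ := by
  obtain ⟨K, hK, -⟩ := exists_subgroup_eq_charKer hψ
  exact ⟨K.map N.subtype, by rw [Subgroup.coe_map, hK]; rfl⟩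

end

variable {G : Type*} [Group G] [Fintype G] {N : Subgroup G} [N.Normal]

theorem le_of_primesOf_subset {M : Subgroup G} (h : primesOf M ⊆ (primesOf (G ⧸ N))ᶜ) :
    M ≤ N := by
  intro x hx
  by_contra hxN
  obtain ⟨p, hp, k, j, hk, hpow⟩ := exists_pow_notMem hxN
  have hcop : (Nat.card M).Coprime (p ^ j) := by
    refine Nat.Coprime.pow_right j (Nat.coprime_comm.1 ((Nat.Prime.coprime_iff_not_dvd hp.1).2 ?_))
    exact fun hd => h ⟨hp.1, hd⟩ hp
  refine hk ?_
  have h1 : orderOf (⟨x ^ k, M.pow_mem hx k⟩ : M) ∣ p ^ j :=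
    orderOf_dvd_of_pow_eq_one (Subtype.ext hpow)
  have h2 : orderOf (⟨x ^ k, M.pow_mem hx k⟩ : M) = 1 :=
    Nat.eq_one_of_dvd_coprimes hcop (orderOf_dvd_natCard _) h1
  rw [orderOf_eq_one_iff] at h2
  have h3 : x ^ k = 1 := congrArg Subtype.val h2
  exact h3 ▸ N.one_mem

theorem centGen_le_iff_forall_indChar {M : Subgroup G} (hM : M.Normal) :
    centGen M ≤ N ↔ M ≤ piCore (primesOf (G ⧸ N))ᶜ G ∧
      ∀ ψ ∈ IrrOver N M, indChar N ψ ∈ Irr G := by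
  rw [le_piCore_iff hM]
  constructor
  · intro h
    refine ⟨primesOf_subset_of_centGen_le hM h, fun ψ hψ => ?_⟩
    rw [indChar_mem_Irr_iff hψ.1]
    exact le_antisymm (inertia_le_of_forall_commute_eq_one (le_of_centGen_le h)
      (centGen_le_iff.1 h) hψ) (le_inertia hψ.1)
  · rintro ⟨hπ, hind⟩
    have hMN := le_of_primesOf_subset hπ
    rw [centGen_le_iff]
    intro g hg x hx hgx
    obtain ⟨p, hp, k, j, hk, hpow⟩ := exists_pow_notMem hg
    have hcop : (Nat.card M).Coprime (p ^ j) := by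
      refine Nat.Coprime.pow_right j
        (Nat.coprime_comm.1 ((Nat.Prime.coprime_iff_not_dvd hp.1).2 ?_))
      exact fun hd => hπ ⟨hp.1, hd⟩ hp
    -- The conjugate `g ^ k * x` is also killed by `p ^ j`, and its factors commute, so `x ^ p ^ j =
    -- 1` while `p` does not divide `|M|`.
    obtain ⟨c, hc⟩ := isConj_iff.1 (isConj_mul_of_notMem hMN hind hk hx)
    have hcomm : Commute (g ^ k) x := Commute.pow_left hgx k
    have h1 : x ^ p ^ j = 1 := by
      have h2 : (g ^ k * x) ^ p ^ j = 1 := by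
        rw [← hc, conj_pow, hpow, mul_one, mul_inv_cancel]
      rwa [hcomm.mul_pow, hpow, one_mul] at h2
    have h3 : orderOf x = 1 :=
      Nat.eq_one_of_dvd_coprimes hcop (Subgroup.orderOf_dvd_natCard M hx)
        (orderOf_dvd_of_pow_eq_one h1)
    rwa [orderOf_eq_one_iff] at h3

/-- The centralizer condition is not visibly preserved by joins, but its character form is: if every
`M` in the family lies in `ker ψ`, so does their join. -/
theorem centGen_frobI_le : centGen (frobI N) ≤ N := by
  rw [centGen_le_iff_forall_indChar (frobI_normal N)]
  refine ⟨sSup_le fun M hM => ((centGen_le_iff_forall_indChar hM.1).1 hM.2).1, fun ψ hψ => ?_⟩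
  by_contra hind
  obtain ⟨K, hK⟩ := exists_subgroup_eq_image_charKer hψ.1
  refine hψ.2 (hK ▸ SetLike.coe_subset_coe.2 ?_)
  refine sSup_le fun M hM => ?_
  by_contra hMK
  refine hind (((centGen_le_iff_forall_indChar hM.1).1 hM.2).2 ψ ⟨hψ.1, ?_⟩)
  rwa [← hK]

theorem le_frobI_iff {M : Subgroup G} (hM : M.Normal) : M ≤ frobI N ↔ centGen M ≤ N :=
  ⟨fun h => centGen_mono h centGen_frobI_le, fun h => le_sSup ⟨hM, h⟩⟩

/-- The normal subgroup `O_{π'}(G) ∩ ⋂ ker ψ`, the intersection being over the irreducible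
characters of `N` with inertia group larger than `N`. -/
theorem exists_normal_eq_piCore_inter_iInter_charKer (N : Subgroup G) [N.Normal] (π : Set ℕ) :
    ∃ L : Subgroup G, L.Normal ∧ (L : Set G) = (piCore π G : Set G) ∩
      ⋂ ψ ∈ {ψ : N → ℂ | ψ ∈ Irr N ∧ N < inertia ψ}, Subtype.val '' charKer ψ := by
  choose! K hK using fun (ψ : N → ℂ) (hψ : ψ ∈ Irr N) => exists_subgroup_eq_image_charKer hψ
  refine ⟨piCore π G ⊓ ⨅ ψ ∈ {ψ : N → ℂ | ψ ∈ Irr N ∧ N < inertia ψ}, K ψ, ⟨fun x hx g => ?_⟩, ?_⟩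
  · rw [Subgroup.mem_inf] at hx ⊢
    refine ⟨(piCore_mem π).1.conj_mem x hx.1 g, ?_⟩
    simp only [Subgroup.mem_iInf] at hx ⊢
    intro ψ hψ
    -- Conjugation permutes the characters being intersected, so `x` lies in the kernel of the
    -- conjugate of `ψ` by `g`.
    have h1 := hx.2 _ ⟨conj_mem_Irr hψ.1 g, lt_inertia_conj hψ.2 g⟩
    rw [← SetLike.mem_coe, hK _ (conj_mem_Irr hψ.1 g)] at h1
    obtain ⟨n, hn, rfl⟩ := h1
    rw [← SetLike.mem_coe, hK ψ hψ.1]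
    refine ⟨MulAut.conjNormal g n, ?_, MulAut.conjNormal_apply g n⟩
    have h2 : ψ (MulAut.conjNormal g n) = ψ (MulAut.conjNormal g 1) := hn
    rwa [map_one] at h2
  · rw [Subgroup.coe_inf]
    congr 1
    simp only [Subgroup.coe_iInf]
    exact Set.iInter₂_congr fun ψ hψ => hK ψ hψ.1

end Main

end FrobeniusTriple

open FrobeniusTriple in
theorem mainTheorem12 {G : Type*} [Group G] [Fintype G] (N : Subgroup G) [N.Normal] :
    (∀ M : Subgroup G, M.Normal →
      (M ≤ frobI N ↔
        M ≤ piCore (primesOf (G ⧸ N))ᶜ G ∧ ∀ ψ ∈ IrrOver N M, indChar N ψ ∈ Irr G)) ∧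
    (frobI N : Set G) =
      (piCore (primesOf (G ⧸ N))ᶜ G : Set G) ∩
        ⋂ ψ ∈ {ψ : N → ℂ | ψ ∈ Irr N ∧ N < inertia ψ}, Subtype.val '' charKer ψ := by
  have hiff : ∀ M : Subgroup G, M.Normal → (M ≤ frobI N ↔
      M ≤ piCore (primesOf (G ⧸ N))ᶜ G ∧ ∀ ψ ∈ IrrOver N M, indChar N ψ ∈ Irr G) :=
    fun M hM => (le_frobI_iff hM).trans (centGen_le_iff_forall_indChar hM)
  refine ⟨hiff, Set.Subset.antisymm ?_ ?_⟩
  · obtain ⟨hcore, hind⟩ := (hiff _ (frobI_normal N)).1 le_rfl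
    refine Set.subset_inter hcore (Set.subset_iInter₂ fun ψ hψ => ?_)
    by_contra hker
    exact hψ.2.ne' ((indChar_mem_Irr_iff hψ.1).1 (hind ψ ⟨hψ.1, hker⟩))
  · obtain ⟨L, hL, hLeq⟩ := exists_normal_eq_piCore_inter_iInter_charKer N (primesOf (G ⧸ N))ᶜ
    rw [← hLeq, SetLike.coe_subset_coe, hiff L hL]
    refine ⟨SetLike.coe_subset_coe.1 (hLeq ▸ Set.inter_subset_left), fun ψ hψ => ?_⟩
    rw [indChar_mem_Irr_iff hψ.1]
    by_contra hne
    -- A stabilizer larger than `N` would make `ker ψ` one of the intersected kernels, contradicting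
    -- `L ≰ ker ψ`.
    refine hψ.2 (hLeq ▸ Set.inter_subset_right.trans (Set.iInter₂_subset ψ ⟨hψ.1, ?_⟩))
    exact lt_of_le_of_ne (le_inertia hψ.1) (Ne.symm hne)
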